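/- Let $M$ be a closed (compact, without boundary), connected, smooth Riemannian manifold, and let $\|\cdot\|_x$ denote the induced norm on $T_x^*M$. Let $G:T^*M\times\mathbb R\to\mathbb R$ be continuous and such that - (G1) there is $K>0$ such that $u\mapsto G(x,p,u)$ is $K$-Lipschitz for every $(x,p)\in T^*M$; - (G2) $p\mapsto G(x,p,u)$ is convex for each $(x,u)\in M\times\mathbb R$; - (G3) $p\mapsto G(x,p,u)$ is superlinear for each $(x,u)\in M\times\mathbb R$, i.e. $G(x,p,u)/\|p\|_x\to+\infty$ as $\|p\|_x\to+\infty$. A function $u\in C(M)$ is a (viscosity) subsolution of $F(x,D_xu,u(x))=c$ in $M$ if $F(x_0,D_{x_0}\varphi,u(x_0))\le c$ for all $\varphi\in C^1(M)$ and $x_0\in M$ such that $u-\varphi$ has a local maximum at $x_0$. Let $c_0$ be the critical value of $H:=G(\cdot,\cdot,0)$, i.e. the smallest $c\in\mathbb R$ for which $H(x,D_xu)=c$ in $M$ has a subsolution, and for $\lambda\in(0,1)$ consider $$G\big(x,D_xu,\lambda u(x)\big)=c_0\qquad\text{in }M.\tag{E$_\lambda$}$$ **Proposition.** Let $\Lambda\subset(0,1)$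 have $0$ as an accumulation point, and let $(w_\lambda)_{\lambda\in\Lambda}$ be a family such that each $w_\lambda\in C(M)$ is a subsolution of (E$_\lambda$). (i) If for each $\lambda\in\Lambda$ there is a point $x_\lambda\in M$ such that $w_\lambda(x_\lambda)\to-\infty$ as $\lambda\to0^+$, $\lambda\in\Lambda$, then $w_\lambda\to-\infty$ uniformly on $M$ as $\lambda\to0^+$, $\lambda\in\Lambda$. (ii) If for each $\lambda\in\Lambda$ there is a point $x_\lambda\in M$ such that $w_\lambda(x_\lambda)\to+\infty$ as $\lambda\to0^+$, $\lambda\in\Lambda$, then $w_\lambda\to+\infty$ uniformly on $M$ as $\lambda\to0^+$, $\lambda\in\Lambda$. -/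

import Mathlib

open Set Filter Topology Bundle
open scoped Manifold ContDiff Bundle

noncomputable section

namespace HamiltonJacobi

section Equation

variable {n : ℕ} {M : Type*} [TopologicalSpace M] [ChartedSpace (EuclideanSpace ℝ (Fin n)) M]

/-- The cotangent space `T_x^*M`. -/
abbrev CotangentSpace (x : M) : Type :=
  TangentSpace (𝓡 n) x →L[ℝ] ℝ

variable (n M) in
/-- The cotangent bundle `T^*M`. It carries Mathlib's topology of the bundle of continuous linear
maps from the tangent bundle to the trivial line bundle. -/
abbrev CotangentBundle [IsManifold (𝓡 n) ∞ M] : Type _ :=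
  Bundle.TotalSpace (EuclideanSpace ℝ (Fin n) →L[ℝ] ℝ) (fun x : M ↦ CotangentSpace (n := n) x)

/-- The differential `D_x φ ∈ T_x^*M` of a real function `φ` on `M`. -/
def differential (φ : M → ℝ) (x : M) : CotangentSpace (n := n) x :=
  mfderiv (𝓡 n) 𝓘(ℝ, ℝ) φ x

variable [IsManifold (𝓡 n) ∞ M]

/-- `u ∈ C(M)` is a viscosity subsolution of `F(x, D_x u, u(x)) = c` in `M`. -/
def IsViscositySubsolution (F : CotangentBundle n M → ℝ → ℝ) (c : ℝ) (u : M → ℝ) : Prop :=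
  Continuous u ∧
    ∀ (φ : M → ℝ) (x₀ : M), ContMDiff (𝓡 n) 𝓘(ℝ, ℝ) 1 φ →
      IsLocalMax (fun x ↦ u x - φ x) x₀ → F ⟨x₀, differential φ x₀⟩ (u x₀) ≤ c

/-- The critical value `c₀` of a Hamiltonian `H : T^*M → ℝ`: the least `c` for which
`H(x, D_x u) = c` has a viscosity subsolution. -/
def criticalValue (H : CotangentBundle n M → ℝ) : ℝ :=
  sInf {c : ℝ | ∃ u : M → ℝ, IsViscositySubsolution (fun q _ ↦ H q) c u}

/-- `w` is a viscosity subsolution of the discounted equation `G(x, D_x w, l w(x)) = c₀` in `M`,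
where `c₀` is the critical value of `H = G(·, ·, 0)`. -/
def IsDiscountedSubsolution (G : CotangentBundle n M → ℝ → ℝ) (l : ℝ) (w : M → ℝ) : Prop :=
  IsViscositySubsolution (fun q u ↦ G q (l * u)) (criticalValue fun q ↦ G q 0) w

/-- `u ↦ G(x, p, u)` is `K`-Lipschitz for some `K > 0`, uniformly in `(x, p) ∈ T^*M`. -/
def IsLipschitzInU (G : CotangentBundle n M → ℝ → ℝ) : Prop :=
  ∃ K : ℝ, 0 < K ∧ ∀ (q : CotangentBundle n M) (u v : ℝ), |G q u - G q v| ≤ K * |u - v|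

/-- `p ↦ G(x, p, u)` is convex for each `(x, u)`. -/
def IsConvexInP (G : CotangentBundle n M → ℝ → ℝ) : Prop :=
  ∀ (x : M) (u : ℝ), ConvexOn ℝ univ fun p : CotangentSpace (n := n) x ↦ G ⟨x, p⟩ u

/-- `p ↦ G(x, p, u)` is superlinear for each `(x, u)`: `G(x, p, u) / ‖p‖ₓ → +∞` as `‖p‖ₓ → +∞`,
where `‖p‖ₓ` is the dual norm of the Riemannian norm on `T_x M`. -/
def IsSuperlinearInP [RiemannianBundle fun x : M ↦ TangentSpace (𝓡 n) x]
    (G : CotangentBundle n M → ℝ → ℝ) : Prop :=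
  ∀ (x : M) (u : ℝ), Tendsto (fun p : CotangentSpace (n := n) x ↦ G ⟨x, p⟩ u / ‖p‖)
    (comap (fun p : CotangentSpace (n := n) x ↦ ‖p‖) atTop) atTop

end Equation

/-- `w l → -∞` uniformly on `M` as `l → 0`, `l ∈ Λ`. -/
def UniformlyTendsToBot {M : Type*} (Λ : Set ℝ) (w : ℝ → M → ℝ) : Prop :=
  ∀ C : ℝ, ∀ᶠ l in 𝓝[Λ] (0 : ℝ), ∀ x : M, w l x ≤ C

/-- `w l → +∞` uniformly on `M` as `l → 0`, `l ∈ Λ`. -/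
def UniformlyTendsToTop {M : Type*} (Λ : Set ℝ) (w : ℝ → M → ℝ) : Prop :=
  ∀ C : ℝ, ∀ᶠ l in 𝓝[Λ] (0 : ℝ), ∀ x : M, C ≤ w l x

end HamiltonJacobi

end

/-!
The critical value plays no role beyond being a fixed real number, and neither does the Riemannian
distance. The point is a Harnack-type inequality, `exists_forall_arsinh_sub_le`: there is a constant
`C` such that `|arsinh (w x) - arsinh (w y)| ≤ C` for all `x, y ∈ M`, all `l ∈ (0, 1)` and all
subsolutions `w` of the equation with discount factor `l`. Since `arsinh` is an increasing bijection
of `ℝ`, divergence of `w l` at the points `x l` then gives uniform divergence on `M`.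

A convex coercive Hamiltonian grows at least linearly, locally uniformly in the base point
(`eventually_linear_growth_of_convexOn`), and `G (x, p, l w)` differs from `G (x, p, 0)` by at
most `K |w|`. A subsolution therefore satisfies `‖Dw‖ < L √(1 + w²)` in a chart near each point,
in the viscosity sense and with `L` independent of `l` and `w`. The nonlinear change of unknown
`z = arsinh w` turns this into `‖Dz‖ < L` (`exists_norm_fderiv_lt`). Comparison with a radial barrier
(`le_add_of_norm_fderiv_lt`) bounds the oscillation of `z` near each point by a constant
independent of `z`, and connectedness and compactness of `M` make this bound global.
-/

namespace HamiltonJacobi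

/-! ### Coercivity of convex functions, and a barrier in Euclidean space -/

/-- A family of convex functions on a finite-dimensional space that depends continuously on a
parameter, and that is coercive at one value `x₀` of the parameter, grows at least linearly,
uniformly for parameters near `x₀`: it exceeds its value at the origin by `1` on a fixed sphere, by
compactness, and convexity propagates this along rays. -/
theorem eventually_linear_growth_of_convexOn {X V : Type*} [TopologicalSpace X]
    [NormedAddCommGroup V] [NormedSpace ℝ V] [FiniteDimensional ℝ V] {h : X → V → ℝ} {x₀ : X}
    (hcont : ∀ ξ : V, ContinuousAt (fun q : X × V ↦ h q.1 q.2) (x₀, ξ))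
    (hconv : ∀ᶠ x in 𝓝 x₀, ConvexOn ℝ univ (h x))
    (hcoer : ∀ C : ℝ, ∃ R : ℝ, ∀ ξ : V, R ≤ ‖ξ‖ → C ≤ h x₀ ξ) :
    ∃ R D : ℝ, 0 < R ∧ ∀ᶠ x in 𝓝 x₀, ∀ ξ : V, R ≤ ‖ξ‖ → ‖ξ‖ / R - D ≤ h x ξ := by
  obtain ⟨R₀, hR₀⟩ := hcoer (h x₀ 0 + 3)
  set R := max R₀ 1
  have hR1 : 1 ≤ R := le_max_right _ _
  have hR : 0 < R := by linarith
  -- `R` is chosen so that `h x₀` exceeds `h x₀ 0` by `3` on the sphere of radius `R`; for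
  -- nearby `x` the gap between the sphere and the origin is still more than `1`.
  have hsphere : ∀ᶠ x in 𝓝 x₀, ∀ ξ ∈ Metric.sphere (0 : V) R, h x₀ 0 + 2 < h x ξ := by
    refine (isCompact_sphere (0 : V) R).eventually_forall_of_forall_eventually fun ξ hξ ↦ ?_
    refine (hcont ξ).eventually_const_lt ?_
    have := hR₀ ξ (by rw [mem_sphere_zero_iff_norm.1 hξ]; exact le_max_left _ _)
    linarith
  have hzero : ContinuousAt (fun x ↦ h x 0) x₀ :=
    ContinuousAt.comp (f := fun x : X ↦ (x, (0 : V))) (hcont 0) (by fun_prop)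
  refine ⟨R, 1 - h x₀ 0, hR, ?_⟩
  filter_upwards [hconv, hsphere, hzero.eventually_const_lt (show h x₀ 0 - 1 < h x₀ 0 by linarith),
    hzero.eventually_lt_const (show h x₀ 0 < h x₀ 0 + 1 by linarith)] with x hx hsx hlow hupp ξ hξ
  have hξ0 : 0 < ‖ξ‖ := by linarith
  have hmem : (R / ‖ξ‖) • ξ ∈ Metric.sphere (0 : V) R := by
    rw [mem_sphere_zero_iff_norm, norm_smul, Real.norm_eq_abs, abs_of_pos (by positivity)]
    field_simp
  -- Convexity on the segment from `0` to `ξ`, which meets the sphere at `(R / ‖ξ‖) • ξ`.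
  have h1 := hx.2 (mem_univ (0 : V)) (mem_univ ξ)
    (show 0 ≤ 1 - R / ‖ξ‖ by rw [sub_nonneg, div_le_one hξ0]; exact hξ)
    (show 0 ≤ R / ‖ξ‖ by positivity) (by ring)
  rw [smul_zero, zero_add, smul_eq_mul, smul_eq_mul] at h1
  have h2 := hsx _ hmem
  have h3 : 1 ≤ (R / ‖ξ‖) * (h x ξ - h x 0) := by linarith
  have h4 : ‖ξ‖ / R ≤ h x ξ - h x 0 := by
    have := mul_le_mul_of_nonneg_left h3 (show 0 ≤ ‖ξ‖ / R by positivity)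
    rw [← mul_assoc, show ‖ξ‖ / R * (R / ‖ξ‖) = 1 by field_simp] at this
    linarith
  linarith

/-- If `‖Dz‖ < L` in the viscosity sense on a ball of radius `r`, then `z` rises by at most `L r +
1` between the centre `y` and a point of the half ball. The bound does not depend on `z`.

The comparison function is the radial barrier `L s + m (s / r) ^ (k + 1)`, `s = ‖v - y‖`, whose
gradient has norm at least `L` away from `y`, which forces `z - barrier` to be maximal at `y`. The
constant `m` bounds the rise of `z` on the ball and keeps the maximum away from the sphere; a
large `k` makes its contribution on the half ball at most `1`. -/
theorem le_add_of_norm_fderiv_lt {E : Type*} [NormedAddCommGroup E] [InnerProductSpace ℝ E]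
    [FiniteDimensional ℝ E] {z : E → ℝ} {y : E} {r L : ℝ} (hr : 0 < r) (hL : 0 < L)
    (hz : ContinuousOn z (Metric.closedBall y r))
    (hsub : ∀ x ∈ Metric.ball y r, ∀ h : E → ℝ, ContDiffAt ℝ 1 h x →
      IsLocalMax (fun v ↦ z v - h v) x → ‖fderiv ℝ h x‖ < L) :
    ∀ x ∈ Metric.closedBall y (r / 2), z x ≤ z y + (L * r + 1) := by
  have hcomp : IsCompact (Metric.closedBall y r) := isCompact_closedBall y r
  have hy : y ∈ Metric.closedBall y r := Metric.mem_closedBall_self hr.le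
  obtain ⟨m, hm0, hm⟩ : ∃ m : ℝ, 0 ≤ m ∧ ∀ x ∈ Metric.closedBall y r, z x ≤ z y + m := by
    obtain ⟨x, hx, hmax⟩ := hcomp.exists_isMaxOn ⟨y, hy⟩ hz
    exact ⟨z x - z y, sub_nonneg.2 (hmax hy), fun v hv ↦ by linarith [isMaxOn_iff.1 hmax v hv]⟩
  obtain ⟨k, hk⟩ : ∃ k : ℕ, m * (1 / 2) ^ (k + 1) ≤ 1 := by
    have h0 : Tendsto (fun k : ℕ ↦ m * (1 / 2 : ℝ) ^ (k + 1)) atTop (𝓝 (m * 0)) :=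
      ((tendsto_pow_atTop_nhds_zero_of_lt_one (by norm_num) (by norm_num)).comp
        (tendsto_add_atTop_nat 1)).const_mul m
    rw [mul_zero] at h0
    exact (h0.eventually_le_const one_pos).exists
  set f : ℝ → ℝ := fun s ↦ L * s + m * (s / r) ^ (k + 1) with hf
  have hf0 : f 0 = 0 := by simp [hf]
  have hfcont : ContDiff ℝ 1 f := by fun_prop
  have hfr : f r = L * r + m := by simp [hf, hr.ne']
  obtain ⟨x₁, hx₁, hmax⟩ := hcomp.exists_isMaxOn ⟨y, hy⟩
    (f := fun v ↦ z v - f ‖v - y‖)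
    (hz.sub (hfcont.continuous.comp (by fun_prop : Continuous fun v : E ↦ ‖v - y‖)).continuousOn)
  have hmax' : ∀ v ∈ Metric.closedBall y r, z v - f ‖v - y‖ ≤ z x₁ - f ‖x₁ - y‖ :=
    isMaxOn_iff.1 hmax
  -- Elsewhere the maximum is excluded: on the sphere by the size of the barrier, in the punctured
  -- open ball by its slope.
  have hx₁y : x₁ = y := by
    by_contra hne
    have hd : 0 < ‖x₁ - y‖ := norm_pos_iff.2 (sub_ne_zero.2 hne)
    have hdr : ‖x₁ - y‖ ≤ r := mem_closedBall_iff_norm.1 hx₁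
    have hlt : ‖x₁ - y‖ < r := by
      refine lt_of_le_of_ne hdr fun heq ↦ ?_
      have h1 := hmax' y hy
      rw [sub_self, norm_zero, hf0, heq, hfr] at h1
      have h2 := hm x₁ hx₁
      nlinarith [mul_pos hL hr]
    have hball : x₁ ∈ Metric.ball y r := mem_ball_iff_norm.2 hlt
    have hne' : x₁ - y ≠ 0 := sub_ne_zero.2 hne
    have hlt' := hsub x₁ hball (fun v ↦ f ‖v - y‖)
      (hfcont.contDiffAt.comp x₁ ((contDiffAt_id.sub contDiffAt_const).norm ℝ hne'))
      (by
        filter_upwards [Metric.isOpen_ball.mem_nhds hball] with v hv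
        exact hmax' v (Metric.ball_subset_closedBall hv))
    have hfd : HasDerivAt f (L + m * ((k + 1) * (‖x₁ - y‖ / r) ^ k * (1 / r))) ‖x₁ - y‖ := by
      have h1 := ((hasDerivAt_id ‖x₁ - y‖).const_mul L).add
        ((((hasDerivAt_id ‖x₁ - y‖).div_const r).pow (k + 1)).const_mul m)
      refine HasDerivAt.congr_deriv h1 ?_
      simp
    have hnorm : HasFDerivAt (fun v : E ↦ ‖v - y‖) (fderiv ℝ (fun v : E ↦ ‖v‖) (x₁ - y)) x₁ := by
      have h1 : DifferentiableAt ℝ (fun v : E ↦ ‖v‖) (x₁ - y) :=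
        (contDiffAt_norm ℝ hne' (n := 1)).differentiableAt (by norm_num)
      exact h1.hasFDerivAt.comp x₁ ((hasFDerivAt_id x₁).sub_const y)
    have hfderiv := (hfd.comp_hasFDerivAt x₁ hnorm).fderiv
    -- The derivative of the barrier in the radial direction `x₁ - y`.
    have hval : fderiv ℝ (fun v ↦ f ‖v - y‖) x₁ (x₁ - y) =
        (L + m * ((k + 1) * (‖x₁ - y‖ / r) ^ k * (1 / r))) * ‖x₁ - y‖ := by
      have h1 : DifferentiableAt ℝ (fun v : E ↦ ‖v‖) (x₁ - y) :=
        (contDiffAt_norm ℝ hne' (n := 1)).differentiableAt (by norm_num)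
      have h2 : fderiv ℝ (fun v : E ↦ ‖v‖) (x₁ - y) (x₁ - y) = ‖x₁ - y‖ :=
        h1.fderiv_norm_self
      change fderiv ℝ (f ∘ fun v ↦ ‖v - y‖) x₁ (x₁ - y) = _
      rw [hfderiv]
      simp [h2]
    have h3 := (le_abs_self _).trans
      ((fderiv ℝ (fun v ↦ f ‖v - y‖) x₁).le_opNorm (x₁ - y))
    rw [hval] at h3
    have h4 := le_of_mul_le_mul_right h3 hd
    have h5 : 0 ≤ m * ((k + 1) * (‖x₁ - y‖ / r) ^ k * (1 / r)) := by positivity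
    linarith
  intro x hx
  have hxr : ‖x - y‖ ≤ r / 2 := mem_closedBall_iff_norm.1 hx
  have h1 := hmax' x (Metric.closedBall_subset_closedBall (by linarith) hx)
  rw [hx₁y, sub_self, norm_zero, hf0] at h1
  have h2 : f ‖x - y‖ ≤ L * r + 1 := by
    have h3 : ‖x - y‖ / r ≤ 1 / 2 := by rw [div_le_iff₀ hr]; linarith
    have h4 : m * (‖x - y‖ / r) ^ (k + 1) ≤ m * (1 / 2) ^ (k + 1) := by gcongr
    have h5 : L * ‖x - y‖ ≤ L * r := by gcongr; linarith
    simp only [hf]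
    linarith
  linarith

/-! ### Local test functions and covectors in a chart -/

variable {n : ℕ} {M : Type*} [TopologicalSpace M]
  [ChartedSpace (EuclideanSpace ℝ (Fin n)) M] [IsManifold (𝓡 n) ∞ M]

/-- A `C¹` germ extends to a global `C¹` function: multiply by a smooth bump function. -/
theorem exists_contMDiff_eventuallyEq [T2Space M] {φ : M → ℝ} {x₀ : M}
    (hφ : ContMDiffAt (𝓡 n) 𝓘(ℝ, ℝ) 1 φ x₀) :
    ∃ φ' : M → ℝ, ContMDiff (𝓡 n) 𝓘(ℝ, ℝ) 1 φ' ∧ φ' =ᶠ[𝓝 x₀] φ := by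
  have hev : ∀ᶠ x in 𝓝 x₀, ContMDiffAt (𝓡 n) 𝓘(ℝ, ℝ) 1 φ x :=
    (contMDiffAt_iff_contMDiffAt_nhds (by simp)).1 hφ
  obtain ⟨f, -, hf⟩ := (SmoothBumpFunction.nhds_basis_tsupport (I := 𝓡 n) x₀).mem_iff.1 hev
  refine ⟨fun x ↦ f x * φ x, contMDiff_of_tsupport fun x hx ↦ ?_, ?_⟩
  · have hx' : x ∈ tsupport f := tsupport_mul_subset_left hx
    have hfx : ContMDiffAt (𝓡 n) 𝓘(ℝ, ℝ) 1 f x := (f.contMDiff.of_le (by norm_num)).contMDiffAt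
    exact hfx.mul (hf hx')
  · filter_upwards [f.eventuallyEq_one] with x hx
    simp [hx]

/-- Test functions need only be `C¹` near the point of contact. -/
theorem IsViscositySubsolution.le_of_contMDiffAt [T2Space M] {F : CotangentBundle n M → ℝ → ℝ}
    {c : ℝ} {u : M → ℝ} (hu : IsViscositySubsolution F c u) {φ : M → ℝ} {x₀ : M}
    (hφ : ContMDiffAt (𝓡 n) 𝓘(ℝ, ℝ) 1 φ x₀) (hmax : IsLocalMax (fun x ↦ u x - φ x) x₀) :
    F ⟨x₀, differential φ x₀⟩ (u x₀) ≤ c := by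
  obtain ⟨φ', hφ', heq⟩ := exists_contMDiff_eventuallyEq hφ
  have hd : (differential φ' x₀ : CotangentSpace (n := n) x₀) = differential φ x₀ :=
    heq.mfderiv_eq
  rw [← hd]
  refine hu.2 φ' x₀ hφ' (hmax.congr ?_)
  filter_upwards [heq] with x hx
  rw [hx]

/-- The covector at `x` with coordinates `ξ` in the chart centred at `x₀`. It is written with the
trivialization of the tangent bundle, which is the derivative of the chart on the chart domain and
has the junk value `0` elsewhere. -/
noncomputable def chartCovector (x₀ x : M) (ξ : EuclideanSpace ℝ (Fin n) →L[ℝ] ℝ) :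
    CotangentSpace (n := n) x :=
  ξ ∘L (trivializationAt (EuclideanSpace ℝ (Fin n)) (TangentSpace (𝓡 n)) x₀).continuousLinearMapAt
    ℝ x

theorem chartCovector_symmL {x₀ x : M}
    (hx : x ∈ (trivializationAt (EuclideanSpace ℝ (Fin n)) (TangentSpace (𝓡 n)) x₀).baseSet)
    (ξ : EuclideanSpace ℝ (Fin n) →L[ℝ] ℝ) (v : EuclideanSpace ℝ (Fin n)) :
    chartCovector x₀ x ξ ((trivializationAt (EuclideanSpace ℝ (Fin n))
      (TangentSpace (𝓡 n)) x₀).symmL ℝ x v) = ξ v :=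
  congrArg ξ (Trivialization.continuousLinearMapAt_symmL _ hx v)

theorem continuousAt_chartCovector (x₀ : M) (ξ : EuclideanSpace ℝ (Fin n) →L[ℝ] ℝ) :
    ContinuousAt (fun q : M × (EuclideanSpace ℝ (Fin n) →L[ℝ] ℝ) ↦
      (⟨q.1, chartCovector x₀ q.1 q.2⟩ : CotangentBundle n M)) (x₀, ξ) := by
  rw [continuousAt_hom_bundle]
  refine ⟨continuousAt_fst, ?_⟩
  refine ContinuousAt.congr (f := Prod.snd) continuousAt_snd ?_
  have hb : ∀ᶠ x in 𝓝 x₀, x ∈ (trivializationAt (EuclideanSpace ℝ (Fin n))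
      (TangentSpace (𝓡 n)) x₀).baseSet :=
    (trivializationAt (EuclideanSpace ℝ (Fin n)) (TangentSpace (𝓡 n)) x₀).open_baseSet.mem_nhds
      (FiberBundle.mem_baseSet_trivializationAt' x₀)
  filter_upwards [continuousAt_fst.eventually hb] with q hq
  ext v
  simpa [ContinuousLinearMap.inCoordinates] using (chartCovector_symmL hq q.2 v).symm

theorem differential_comp_extChartAt {x₀ x : M}
    (hx : x ∈ (chartAt (EuclideanSpace ℝ (Fin n)) x₀).source) {h : EuclideanSpace ℝ (Fin n) → ℝ}
    (hh : DifferentiableAt ℝ h (extChartAt (𝓡 n) x₀ x)) :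
    differential (fun y ↦ h (extChartAt (𝓡 n) x₀ y)) x =
      chartCovector x₀ x (fderiv ℝ h (extChartAt (𝓡 n) x₀ x)) := by
  have h1 := mfderiv_comp x (I := 𝓡 n) (g := h) (f := extChartAt (𝓡 n) x₀) hh.mdifferentiableAt
    (mdifferentiableAt_extChartAt hx)
  rw [chartCovector, TangentBundle.continuousLinearMapAt_trivializationAt hx, ← mfderiv_eq_fderiv]
  exact h1

theorem chartCovector_affine (x₀ x : M) (u v : EuclideanSpace ℝ (Fin n) →L[ℝ] ℝ) (a b : ℝ) :
    chartCovector x₀ x (a • u + b • v) = a • chartCovector x₀ x u + b • chartCovector x₀ x v := by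
  ext w
  simp [chartCovector]

theorem norm_le_mul_norm_chartCovector
    [RiemannianBundle fun x : M ↦ TangentSpace (𝓡 n) x] (x₀ : M) :
    ∃ C : ℝ, 0 < C ∧ ∀ ξ : EuclideanSpace ℝ (Fin n) →L[ℝ] ℝ,
      ‖ξ‖ ≤ C * ‖chartCovector x₀ x₀ ξ‖ := by
  set B : EuclideanSpace ℝ (Fin n) →L[ℝ] TangentSpace (𝓡 n) x₀ :=
    (trivializationAt (EuclideanSpace ℝ (Fin n)) (TangentSpace (𝓡 n)) x₀).symmL ℝ x₀
  refine ⟨‖B‖ + 1, by positivity, fun ξ ↦ ?_⟩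
  have hξ : ξ = (chartCovector x₀ x₀ ξ) ∘L B := by
    ext v
    exact (chartCovector_symmL (FiberBundle.mem_baseSet_trivializationAt' x₀) ξ v).symm
  calc ‖ξ‖ = ‖(chartCovector x₀ x₀ ξ) ∘L B‖ := by rw [← hξ]
    _ ≤ ‖chartCovector x₀ x₀ ξ‖ * ‖B‖ := ContinuousLinearMap.opNorm_comp_le _ _
    _ ≤ _ := by nlinarith [norm_nonneg (chartCovector x₀ x₀ ξ)]

theorem coercive_of_isSuperlinearInP
    [RiemannianBundle fun x : M ↦ TangentSpace (𝓡 n) x] {G : CotangentBundle n M → ℝ → ℝ}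
    (hG3 : IsSuperlinearInP G) (x₀ : M) (u C : ℝ) :
    ∃ R : ℝ, ∀ ξ : EuclideanSpace ℝ (Fin n) →L[ℝ] ℝ, R ≤ ‖ξ‖ →
      C ≤ G ⟨x₀, chartCovector x₀ x₀ ξ⟩ u := by
  obtain ⟨B, hB, hnorm⟩ := norm_le_mul_norm_chartCovector (n := n) x₀
  -- Superlinearity is used only through `G ≥ ‖p‖` for large `‖p‖`.
  have h1 := (hG3 x₀ u).eventually_ge_atTop 1
  rw [eventually_comap] at h1
  obtain ⟨r, hr⟩ := h1.exists_forall_of_atTop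
  refine ⟨B * max (max r C) 1, fun ξ hξ ↦ ?_⟩
  have h2 : max (max r C) 1 ≤ ‖chartCovector x₀ x₀ ξ‖ :=
    le_of_mul_le_mul_left (hξ.trans (hnorm ξ)) hB
  have h3 := hr _ ((le_max_left _ _).trans ((le_max_left _ _).trans h2)) _ rfl
  have h4 : 1 ≤ ‖chartCovector x₀ x₀ ξ‖ := (le_max_right _ _).trans h2
  rw [le_div_iff₀ (by linarith), one_mul] at h3
  exact (((le_max_right r C).trans (le_max_left _ _)).trans h2).trans h3

/-! ### Gradient bounds in a chart -/

/-- Local coercivity of `G`, uniform in the base point and linear in the bound `s` on `u`: the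
Lipschitz dependence on `u` costs at most `K s`, which linear growth in `ξ` compensates. -/
theorem exists_lt_of_mul_le_norm [RiemannianBundle fun x : M ↦ TangentSpace (𝓡 n) x]
    {G : CotangentBundle n M → ℝ → ℝ}
    (hG : Continuous fun q : CotangentBundle n M × ℝ ↦ G q.1 q.2)
    (hG1 : IsLipschitzInU G) (hG2 : IsConvexInP G) (hG3 : IsSuperlinearInP G) (x₀ : M) (c : ℝ) :
    ∃ L : ℝ, 0 < L ∧ ∀ᶠ x in 𝓝 x₀, ∀ (ξ : EuclideanSpace ℝ (Fin n) →L[ℝ] ℝ) (u s : ℝ),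
      1 ≤ s → |u| ≤ s → L * s ≤ ‖ξ‖ → c < G ⟨x, chartCovector x₀ x ξ⟩ u := by
  obtain ⟨K, hK, hLip⟩ := hG1
  obtain ⟨R, D, hR, hev⟩ := eventually_linear_growth_of_convexOn (x₀ := x₀)
    (h := fun x (ξ : EuclideanSpace ℝ (Fin n) →L[ℝ] ℝ) ↦ G ⟨x, chartCovector x₀ x ξ⟩ 0)
    (fun ξ ↦ ContinuousAt.comp (g := fun q : CotangentBundle n M ↦ G q 0)
      (hG.comp (by fun_prop : Continuous fun q : CotangentBundle n M ↦ (q, (0 : ℝ)))).continuousAt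
      (continuousAt_chartCovector x₀ ξ))
    (Eventually.of_forall fun x ↦ ⟨convex_univ, fun ξ _ η _ a b ha hb hab ↦ by
      simp only [chartCovector_affine]
      exact (hG2 x 0).2 (mem_univ _) (mem_univ _) ha hb hab⟩)
    (coercive_of_isSuperlinearInP hG3 x₀ 0)
  refine ⟨R * (|D| + |c| + K + 1), by positivity, ?_⟩
  filter_upwards [hev] with x hx ξ u s hs hu hξ
  have hA : 1 ≤ |D| + |c| + K + 1 := by linarith [abs_nonneg D, abs_nonneg c]
  have h1 : (|D| + |c| + K + 1) * s ≤ ‖ξ‖ / R := by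
    rw [le_div_iff₀ hR]; linarith
  have h2 : R ≤ ‖ξ‖ := by
    have : 1 ≤ ‖ξ‖ / R := by nlinarith
    rwa [le_div_iff₀ hR, one_mul] at this
  have h3 := hx ξ h2
  have h4 := (abs_le.1 (hLip ⟨x, chartCovector x₀ x ξ⟩ u 0)).1
  rw [sub_zero] at h4
  have h5 : K * |u| ≤ K * s := by gcongr
  nlinarith [le_abs_self D, le_abs_self c, abs_nonneg D, abs_nonneg c]

/-- The change of unknown `z = arsinh u`, in the viscosity sense and in the chart centred at `x₀`:
if `h` touches `z` from above then `sinh ∘ h`, up to a constant added to `h`, touches `u` from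
above, and its derivative is `cosh z = √(1 + u²)` times that of `h`. -/
theorem IsViscositySubsolution.arsinh_le [T2Space M] {F : CotangentBundle n M → ℝ → ℝ}
    {c : ℝ} {u : M → ℝ} (hu : IsViscositySubsolution F c u) {x₀ x : M}
    (hx : x ∈ (chartAt (EuclideanSpace ℝ (Fin n)) x₀).source)
    {h : EuclideanSpace ℝ (Fin n) → ℝ} (hh : ContDiffAt ℝ 1 h (extChartAt (𝓡 n) x₀ x))
    (hmax : IsLocalMax (fun y ↦ Real.arsinh (u y) - h (extChartAt (𝓡 n) x₀ y)) x) :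
    F ⟨x, chartCovector x₀ x
      (√(1 + u x ^ 2) • fderiv ℝ h (extChartAt (𝓡 n) x₀ x))⟩ (u x) ≤ c := by
  set ψ := extChartAt (𝓡 n) x₀
  set b := Real.arsinh (u x) - h (ψ x)
  have hb : h (ψ x) + b = Real.arsinh (u x) := by simp [b]
  have hg : ContDiffAt ℝ 1 (fun v ↦ Real.sinh (h v + b)) (ψ x) :=
    Real.contDiff_sinh.contDiffAt.comp _ (hh.add contDiffAt_const)
  have hfd : fderiv ℝ (fun v ↦ Real.sinh (h v + b)) (ψ x) =
      √(1 + u x ^ 2) • fderiv ℝ h (ψ x) := by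
    have h1 := ((hh.differentiableAt (by norm_num)).hasFDerivAt.add_const b).sinh.fderiv
    rwa [hb, Real.cosh_arsinh] at h1
  rw [← hfd, ← differential_comp_extChartAt hx (hg.differentiableAt (by norm_num))]
  refine hu.le_of_contMDiffAt ?_ ?_
  · exact ContMDiffAt.comp (g := fun v ↦ Real.sinh (h v + b)) (f := ψ) x hg.contMDiffAt
      (contMDiffAt_extChartAt' hx)
  · filter_upwards [hmax] with y hy
    have h1 : Real.arsinh (u y) ≤ h (ψ y) + b := by simp only [b]; linarith
    have h2 : u y ≤ Real.sinh (h (ψ y) + b) := by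
      rw [← Real.sinh_arsinh (u y)]; exact Real.sinh_le_sinh.2 h1
    change u y - Real.sinh (h (ψ y) + b) ≤ u x - Real.sinh (h (ψ x) + b)
    rw [hb, Real.sinh_arsinh]
    linarith

/-- Near `x₀`, the functions `arsinh ∘ w`, for `w` a subsolution of a discounted equation, satisfy
`‖Dz‖ < L` in the chart in the viscosity sense, with `L` independent of `w` and of the discount
factor. -/
theorem exists_norm_fderiv_lt [T2Space M] [RiemannianBundle fun x : M ↦ TangentSpace (𝓡 n) x]
    {G : CotangentBundle n M → ℝ → ℝ}
    (hG : Continuous fun q : CotangentBundle n M × ℝ ↦ G q.1 q.2)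
    (hG1 : IsLipschitzInU G) (hG2 : IsConvexInP G) (hG3 : IsSuperlinearInP G) (x₀ : M) :
    ∃ L : ℝ, 0 < L ∧ ∀ᶠ x in 𝓝 x₀, ∀ l ∈ Ioo (0 : ℝ) 1, ∀ w : M → ℝ,
      IsDiscountedSubsolution G l w → ∀ h : EuclideanSpace ℝ (Fin n) → ℝ,
      ContDiffAt ℝ 1 h (extChartAt (𝓡 n) x₀ x) →
      IsLocalMax (fun y ↦ Real.arsinh (w y) - h (extChartAt (𝓡 n) x₀ y)) x →
      ‖fderiv ℝ h (extChartAt (𝓡 n) x₀ x)‖ < L := by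
  obtain ⟨L, hL, hev⟩ := exists_lt_of_mul_le_norm hG hG1 hG2 hG3 x₀
    (criticalValue fun q ↦ G q 0)
  refine ⟨L, hL, ?_⟩
  filter_upwards [hev, (chartAt (EuclideanSpace ℝ (Fin n)) x₀).open_source.mem_nhds
    (mem_chart_source _ x₀)] with x hx hxs l hl w hw h hh hmax
  -- The covector `√(1 + w²) Dh` is admissible for `w`, and has norm at least `L √(1 + w²)` if
  -- `‖Dh‖ ≥ L`, while `|l w| ≤ √(1 + w²)`: coercivity with `s = √(1 + w²)` is contradicted.
  by_contra! hle
  have hs : 1 ≤ √(1 + w x ^ 2) := Real.one_le_sqrt.2 (by nlinarith [sq_nonneg (w x)])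
  have hws : |l * w x| ≤ √(1 + w x ^ 2) := by
    refine Real.abs_le_sqrt ?_
    have : l ^ 2 ≤ 1 := by nlinarith [hl.1, hl.2]
    nlinarith [sq_nonneg (w x)]
  refine (hx (√(1 + w x ^ 2) • fderiv ℝ h (extChartAt (𝓡 n) x₀ x)) (l * w x) _ hs hws ?_).not_ge
    (IsViscositySubsolution.arsinh_le hw hxs hh hmax)
  rw [norm_smul, Real.norm_eq_abs, abs_of_nonneg (Real.sqrt_nonneg _), mul_comm]
  gcongr

/-! ### Oscillation bounds -/

theorem eventually_arsinh_sub_le [T2Space M] [RiemannianBundle fun x : M ↦ TangentSpace (𝓡 n) x]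
    {G : CotangentBundle n M → ℝ → ℝ}
    (hG : Continuous fun q : CotangentBundle n M × ℝ ↦ G q.1 q.2)
    (hG1 : IsLipschitzInU G) (hG2 : IsConvexInP G) (hG3 : IsSuperlinearInP G) (x₀ : M) :
    ∃ C : ℝ, ∀ᶠ x in 𝓝 x₀, ∀ l ∈ Ioo (0 : ℝ) 1, ∀ w : M → ℝ, IsDiscountedSubsolution G l w →
      |Real.arsinh (w x) - Real.arsinh (w x₀)| ≤ C := by
  obtain ⟨L, hL, hev⟩ := exists_norm_fderiv_lt hG hG1 hG2 hG3 x₀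
  set ψ := extChartAt (𝓡 n) x₀
  have hx₀ : x₀ ∈ ψ.source := mem_extChartAt_source x₀
  have htarget : ψ.target ∈ 𝓝 (ψ x₀) := extChartAt_target_mem_nhds x₀
  have hsymm : Tendsto ψ.symm (𝓝 (ψ x₀)) (𝓝 x₀) := by
    have := continuousAt_extChartAt_symm (I := 𝓡 n) x₀
    simpa [ContinuousAt, ψ] using this
  obtain ⟨r, hr, hball⟩ := Metric.nhds_basis_closedBall.mem_iff.1
    (inter_mem htarget (hsymm.eventually hev))
  -- Both `x₀` and `x` serve as centres, hence the ball of centre `v` and half the radius.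
  have key : ∀ l ∈ Ioo (0 : ℝ) 1, ∀ w : M → ℝ, IsDiscountedSubsolution G l w →
      ∀ v ∈ Metric.closedBall (ψ x₀) (r / 2), ∀ v' ∈ Metric.closedBall v (r / 2 / 2),
      Real.arsinh (w (ψ.symm v')) ≤ Real.arsinh (w (ψ.symm v)) + (L * (r / 2) + 1) := by
    intro l hl w hw v hv
    have hsub : Metric.closedBall v (r / 2) ⊆ Metric.closedBall (ψ x₀) r :=
      Metric.closedBall_subset_closedBall' (by rw [Metric.mem_closedBall] at hv; linarith)
    refine le_add_of_norm_fderiv_lt (z := fun v ↦ Real.arsinh (w (ψ.symm v))) (by positivity) hL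
      ?_ ?_
    · exact (Real.continuous_arsinh.comp hw.1).comp_continuousOn
        ((continuousOn_extChartAt_symm x₀).mono fun a ha ↦ (hball (hsub ha)).1)
    · intro a ha h hh hmax
      obtain ⟨hat, hae⟩ := hball (hsub (Metric.ball_subset_closedBall ha))
      have has : ψ.symm a ∈ ψ.source := ψ.map_target hat
      have hψa : ψ (ψ.symm a) = a := ψ.right_inv hat
      have := hae l hl w hw h (by rwa [hψa]) ?_
      · rwa [hψa] at this
      · have hcont : Tendsto ψ (𝓝 (ψ.symm a)) (𝓝 a) := by
          have := continuousAt_extChartAt' (I := 𝓡 n) has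
          rwa [ContinuousAt, hψa] at this
        filter_upwards [hcont.eventually hmax, extChartAt_source_mem_nhds' (I := 𝓡 n) has]
          with y hy hys
        rw [ψ.left_inv hys] at hy
        rw [hψa]
        exact hy
  refine ⟨L * (r / 2) + 1, ?_⟩
  filter_upwards [(continuousAt_extChartAt (I := 𝓡 n) x₀).eventually
    (Metric.closedBall_mem_nhds (ψ x₀) (by positivity : 0 < r / 2 / 2)),
    extChartAt_source_mem_nhds (I := 𝓡 n) x₀] with x hx hxs l hl w hw
  have h1 := key l hl w hw (ψ x₀) (Metric.mem_closedBall_self (by positivity)) (ψ x) hx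
  have h2 := key l hl w hw (ψ x) (Metric.closedBall_subset_closedBall (by linarith) hx) (ψ x₀)
    (by rw [Metric.mem_closedBall, dist_comm]; exact hx)
  rw [ψ.left_inv hx₀, ψ.left_inv hxs] at h1 h2
  rw [abs_le]
  constructor <;> linarith

/-- A Harnack-type inequality: the oscillation of `arsinh ∘ w` over `M` is bounded by one
constant for all subsolutions `w` of all discounted equations. -/
theorem exists_forall_arsinh_sub_le [T2Space M] [CompactSpace M] [ConnectedSpace M]
    [RiemannianBundle fun x : M ↦ TangentSpace (𝓡 n) x] {G : CotangentBundle n M → ℝ → ℝ}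
    (hG : Continuous fun q : CotangentBundle n M × ℝ ↦ G q.1 q.2)
    (hG1 : IsLipschitzInU G) (hG2 : IsConvexInP G) (hG3 : IsSuperlinearInP G) :
    ∃ C : ℝ, ∀ l ∈ Ioo (0 : ℝ) 1, ∀ w : M → ℝ, IsDiscountedSubsolution G l w →
      ∀ x y : M, |Real.arsinh (w x) - Real.arsinh (w y)| ≤ C := by
  have hloc := eventually_arsinh_sub_le hG hG1 hG2 hG3
  -- Having a uniform bound for `x` and `y` is an equivalence relation with open classes, so
  -- connectedness leaves a single class.
  have hpair : ∀ x y : M, ∃ C : ℝ, ∀ l ∈ Ioo (0 : ℝ) 1, ∀ w : M → ℝ,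
      IsDiscountedSubsolution G l w → |Real.arsinh (w x) - Real.arsinh (w y)| ≤ C := by
    refine PreconnectedSpace.induction₂' _ (fun x ↦ ?_) ⟨?_⟩
    · obtain ⟨C, hC⟩ := hloc x
      filter_upwards [hC] with y hy
      exact ⟨⟨C, fun l hl w hw ↦ by rw [abs_sub_comm]; exact hy l hl w hw⟩, C, hy⟩
    · rintro x y z ⟨C, hC⟩ ⟨C', hC'⟩
      exact ⟨C + C', fun l hl w hw ↦ (abs_sub_le _ _ _).trans
        (add_le_add (hC l hl w hw) (hC' l hl w hw))⟩
  -- Compactness makes the bound uniform in the point.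
  obtain ⟨y₀⟩ := (inferInstance : Nonempty M)
  obtain ⟨C, hC⟩ : ∃ C : ℝ, ∀ x ∈ (univ : Set M), ∀ l ∈ Ioo (0 : ℝ) 1, ∀ w : M → ℝ,
      IsDiscountedSubsolution G l w → |Real.arsinh (w x) - Real.arsinh (w y₀)| ≤ C := by
    refine isCompact_univ.induction_on (p := fun s ↦ ∃ C : ℝ, ∀ x ∈ s, ∀ l ∈ Ioo (0 : ℝ) 1,
      ∀ w : M → ℝ, IsDiscountedSubsolution G l w →
      |Real.arsinh (w x) - Real.arsinh (w y₀)| ≤ C) ⟨0, by simp⟩ ?_ ?_ ?_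
    · rintro s t hst ⟨C, hC⟩
      exact ⟨C, fun x hx ↦ hC x (hst hx)⟩
    · rintro s t ⟨C, hC⟩ ⟨C', hC'⟩
      refine ⟨max C C', fun x hx l hl w hw ↦ hx.elim (fun hx ↦ ?_) (fun hx ↦ ?_)⟩
      · exact (hC x hx l hl w hw).trans (le_max_left _ _)
      · exact (hC' x hx l hl w hw).trans (le_max_right _ _)
    · intro x _
      obtain ⟨C, hC⟩ := hloc x
      obtain ⟨C', hC'⟩ := hpair x y₀
      exact ⟨_, mem_nhdsWithin_of_mem_nhds hC, C + C', fun y hy l hl w hw ↦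
        (abs_sub_le _ _ _).trans (add_le_add (hy l hl w hw) (hC' l hl w hw))⟩
  refine ⟨C + C, fun l hl w hw x y ↦ (abs_sub_le _ (Real.arsinh (w y₀)) _).trans
    (add_le_add (hC x (mem_univ x) l hl w hw) ?_)⟩
  rw [abs_sub_comm]
  exact hC y (mem_univ y) l hl w hw

end HamiltonJacobi

theorem mainTheorem7 {n : ℕ} {M : Type*} [MetricSpace M] [CompactSpace M] [ConnectedSpace M]
    [ChartedSpace (EuclideanSpace ℝ (Fin n)) M] [IsManifold (𝓡 n) ∞ M]
    [RiemannianBundle fun x : M ↦ TangentSpace (𝓡 n) x]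
    [IsContMDiffRiemannianBundle (𝓡 n) ∞ (EuclideanSpace ℝ (Fin n))
      fun x : M ↦ TangentSpace (𝓡 n) x]
    [IsRiemannianManifold (𝓡 n) M]
    (G : HamiltonJacobi.CotangentBundle n M → ℝ → ℝ)
    (hG : Continuous fun q : HamiltonJacobi.CotangentBundle n M × ℝ ↦ G q.1 q.2)
    (hG1 : HamiltonJacobi.IsLipschitzInU G)
    (hG2 : HamiltonJacobi.IsConvexInP G)
    (hG3 : HamiltonJacobi.IsSuperlinearInP G)
    (Λ : Set ℝ) (hΛ : Λ ⊆ Ioo 0 1) (hΛ0 : AccPt 0 (𝓟 Λ))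
    (w : ℝ → M → ℝ)
    (hw : ∀ l ∈ Λ, HamiltonJacobi.IsDiscountedSubsolution G l (w l)) :
    ((∃ x : ℝ → M, Tendsto (fun l ↦ w l (x l)) (𝓝[Λ] 0) atBot) →
      HamiltonJacobi.UniformlyTendsToBot Λ w) ∧
    ((∃ x : ℝ → M, Tendsto (fun l ↦ w l (x l)) (𝓝[Λ] 0) atTop) →
      HamiltonJacobi.UniformlyTendsToTop Λ w) := by
  obtain ⟨C, hC⟩ := HamiltonJacobi.exists_forall_arsinh_sub_le hG hG1 hG2 hG3
  constructor
  · rintro ⟨x, hx⟩ B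
    filter_upwards [self_mem_nhdsWithin,
      hx.eventually_le_atBot (Real.sinh (Real.arsinh B - C))] with l hl hle y
    have h1 := (abs_le.1 (hC l (hΛ hl) (w l) (hw l hl) y (x l))).2
    have h2 := Real.arsinh_le_arsinh.2 hle
    rw [Real.arsinh_sinh] at h2
    exact Real.arsinh_le_arsinh.1 (by linarith)
  · rintro ⟨x, hx⟩ B
    filter_upwards [self_mem_nhdsWithin,
      hx.eventually_ge_atTop (Real.sinh (Real.arsinh B + C))] with l hl hle y
    have h1 := (abs_le.1 (hC l (hΛ hl) (w l) (hw l hl) y (x l))).1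
    have h2 := Real.arsinh_le_arsinh.2 hle
    rw [Real.arsinh_sinh] at h2
    exact Real.arsinh_le_arsinh.1 (by linarith)
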